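/- Identify $M_2(\mathbb C)\otimes M_2(\mathbb C)\otimes M_2(\mathbb C)$ with the $8\times 8$ complex matrices, using the lexicographic order of the indices of the three qubits $A,B,C$. Let $\alpha$ (respectively $\beta$, $\gamma$) be the convex cone of all un-normalized three qubit states that are $A$-$BC$ (respectively $B$-$CA$, $C$-$AB$) separable, that is, of all finite sums of rank one matrices $|\psi\rangle\langle\psi|$ where $\psi$ is a product vector for the bipartition $A$-$BC$ (respectively $B$-$CA$, $C$-$AB$). For convex cones $\sigma,\tau$ write $\sigma\wedge\tau=\sigma\cap\tau$ and let $\sigma\vee\tau=\sigma+\tau$ be the convex hull of $\sigma\cup\tau$. Let $\mathsf X$ be the real vector space of all self-adjoint $8\times8$ matrices all of whose entries off the diagonal and the anti-diagonal are zero, and let $\sigma_{\mathsf X}=\sigma\cap\mathsf X$ denote the $\mathsf X$-part of a convex cone $\sigma$. Put $$P=[\alpha\vee(\beta\wedge\gamma)]\wedge[\beta\vee(\gamma\wedge\alpha)]\wedge[\gamma\vee(\alpha\wedge\beta)].$$ Then $$\begin{aligned} (\alpha_{\mathsf X}\wedge\beta_{\mathsf X})\vee(\alpha_{\mathsf X}\wedge\gamma_{\mathsf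 X})&=\alpha_{\mathsf X}\wedge P_{\mathsf X},\\ (\beta_{\mathsf X}\wedge\gamma_{\mathsf X})\vee(\beta_{\mathsf X}\wedge\alpha_{\mathsf X})&=\beta_{\mathsf X}\wedge P_{\mathsf X},\\ (\gamma_{\mathsf X}\wedge\alpha_{\mathsf X})\vee(\gamma_{\mathsf X}\wedge\beta_{\mathsf X})&=\gamma_{\mathsf X}\wedge P_{\mathsf X}. \end{aligned}$$ -/

import Mathlib

/-- Index of the standard basis vector `|i⟩ ⊗ |j⟩ ⊗ |k⟩` of `ℂ² ⊗ ℂ² ⊗ ℂ²`; the three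
components belong to the subsystems `A`, `B`, `C`. -/
abbrev QIdx : Type := Fin 2 × Fin 2 × Fin 2

/-- Matrices in `M₂ ⊗ M₂ ⊗ M₂ = M₈`, a real vector space. -/
abbrev QMat : Type := Matrix QIdx QIdx ℂ

/-- The rank one matrix `|ψ⟩⟨ψ|`. -/
def pureState (ψ : QIdx → ℂ) : QMat := Matrix.vecMulVec ψ (star ψ)

/-- The convex cone `α` of un-normalised `A`-`BC` separable states: finite nonnegative
combinations of the pure states `|a ⊗ b⟩⟨a ⊗ b|` with `a` in `A` and `b` in `B ⊗ C`. -/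
noncomputable def sepA : PointedCone ℝ QMat :=
  PointedCone.hull ℝ
    {M | ∃ (a : Fin 2 → ℂ) (b : Fin 2 × Fin 2 → ℂ),
      M = pureState (fun p => a p.1 * b (p.2.1, p.2.2))}

/-- The convex cone `β` of un-normalised `B`-`CA` separable states. -/
noncomputable def sepB : PointedCone ℝ QMat :=
  PointedCone.hull ℝ
    {M | ∃ (a : Fin 2 → ℂ) (b : Fin 2 × Fin 2 → ℂ),
      M = pureState (fun p => a p.2.1 * b (p.2.2, p.1))}

/-- The convex cone `γ` of un-normalised `C`-`AB` separable states. -/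
noncomputable def sepC : PointedCone ℝ QMat :=
  PointedCone.hull ℝ
    {M | ∃ (a : Fin 2 → ℂ) (b : Fin 2 × Fin 2 → ℂ),
      M = pureState (fun p => a p.2.2 * b (p.1, p.2.1))}

/-- The index opposite to `p`. In the lexicographic order of the eight indices, `p` and
`oppIdx p` are the row and the column of an anti-diagonal entry. -/
def oppIdx (p : QIdx) : QIdx := (p.1.rev, p.2.1.rev, p.2.2.rev)

/-- The real vector space of self-adjoint `X`-shaped matrices: all entries are zero except for
diagonal and anti-diagonal ones. -/
def xSpace : Submodule ℝ QMat where
  carrier := {M | M.IsHermitian ∧ ∀ p q, q ≠ p → q ≠ oppIdx p → M p q = 0}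
  zero_mem' := ⟨Matrix.isHermitian_zero, fun _ _ _ _ => rfl⟩
  add_mem' := by
    rintro M N ⟨hM, hM'⟩ ⟨hN, hN'⟩
    refine ⟨hM.add hN, fun p q h₁ h₂ => ?_⟩
    rw [Matrix.add_apply, hM' p q h₁ h₂, hN' p q h₁ h₂, add_zero]
  smul_mem' := by
    rintro c M ⟨hM, hM'⟩
    refine ⟨?_, fun p q h₁ h₂ => ?_⟩
    · change (c • M).conjTranspose = c • M
      rw [Matrix.conjTranspose_smul, hM.eq, star_trivial]
    · rw [Matrix.smul_apply, hM' p q h₁ h₂, smul_zero]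

/-- The `X`-part `σ_X = σ ∩ X` of a convex cone `σ`. -/
noncomputable def xPart (σ : PointedCone ℝ QMat) : PointedCone ℝ QMat :=
  σ ⊓ PointedCone.ofSubmodule xSpace

/-- `P = [α ∨ (β ∧ γ)] ∧ [β ∨ (γ ∧ α)] ∧ [γ ∨ (α ∧ β)]`. In the lattice of convex cones containing
zero, `⊓` is the intersection and `⊔` is the convex hull of the union, that is, the sum. -/
noncomputable def coneP : PointedCone ℝ QMat :=
  (sepA ⊔ (sepB ⊓ sepC)) ⊓ (sepB ⊔ (sepC ⊓ sepA)) ⊓ (sepC ⊔ (sepA ⊓ sepB))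

/-!
For a matrix `M` let `s q = √(M q q * M (oppIdx q) (oppIdx q))` be the geometric mean of two opposite
diagonal entries and `r q = ‖M q (oppIdx q)‖` the modulus of the anti-diagonal entry between them.
An `X`-shaped matrix with nonnegative diagonal is separable with respect to the bipartition that
separates the qubit `i` exactly if `r q ≤ s q` and `r q ≤ s (flipIdx i q)` for all `q`.

* These inequalities hold on the whole separable cone, not only on its `X`-part
  (`antidiagLE_of_mem_sep`): they hold for product vectors, and `s` is superadditive.
* They suffice for `X`-shaped matrices (`mem_sep_of_antidiagLE`). The matrix is a sum of blocks, each
  supported on `q`, `flipIdx i q` and their opposites. A block whose two anti-diagonal entries both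
  have the modulus `s q = s (flipIdx i q)` is a sum of two product states up to a factor, and all
  other blocks come from these by averaging and by adding diagonal matrices.

Both `s` and `r` depend only on the pair `{q, oppIdx q}`, and there are four such pairs, permuted by
the three flips as by the Klein four-group. Membership in `α` and in `P` therefore gives linear
inequalities between four numbers `s` and four numbers `r`, and a decomposition in
`(α ∧ β) ∨ (α ∧ γ)` amounts to a splitting `s = x + y` such that `r` is at most the sum of the bound
that `x` allows in `α ∧ β` and the bound that `y` allows in `α ∧ γ`. The lemma
`exists_add_eq_of_le` writes down such a splitting, starting from the pair on which `s` is minimal.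
The splitting is realised on matrices by scaling entries (`xScale`). The opposite inclusion is
formal, and the three identities are the same statement for three orders of the qubits.
-/

open Matrix

/-! ### Flips of the indices -/

/-- The involution of the indices that flips the `i`-th qubit. -/
def flipIdx : Fin 3 → QIdx → QIdx
  | 0, q => (q.1.rev, q.2.1, q.2.2)
  | 1, q => (q.1, q.2.1.rev, q.2.2)
  | 2, q => (q.1, q.2.1, q.2.2.rev)

/-- The `i`-th component of an index. -/
def coord : Fin 3 → QIdx → Fin 2
  | 0, q => q.1
  | 1, q => q.2.1
  | 2, q => q.2.2

theorem oppIdx_oppIdx : ∀ q, oppIdx (oppIdx q) = q := by decide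
theorem flipIdx_flipIdx : ∀ i q, flipIdx i (flipIdx i q) = q := by decide
theorem oppIdx_flipIdx : ∀ i q, oppIdx (flipIdx i q) = flipIdx i (oppIdx q) := by decide
theorem oppIdx_ne : ∀ q, oppIdx q ≠ q := by decide
theorem flipIdx_ne : ∀ i q, flipIdx i q ≠ q := by decide
theorem flipIdx_ne_oppIdx : ∀ i q, flipIdx i q ≠ oppIdx q := by decide
theorem coord_flipIdx_ne : ∀ i q, coord i (flipIdx i q) ≠ coord i q := by decide
theorem coord_oppIdx_ne : ∀ i q, coord i (oppIdx q) ≠ coord i q := by decide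
theorem coord_oppIdx_flipIdx : ∀ i q, coord i (oppIdx (flipIdx i q)) = coord i q := by decide

/-- The class of `q` modulo `oppIdx`, labelled relative to a base point `p`: the labels `0, 1, 2, 3`
are those of `p` and of `p` with the qubit `k`, the qubit `j` and the remaining qubit flipped. -/
def label (j k : Fin 3) (p q : QIdx) : Fin 4 :=
  if q = p ∨ q = oppIdx p then 0
  else if q = flipIdx k p ∨ q = oppIdx (flipIdx k p) then 1
  else if q = flipIdx j p ∨ q = oppIdx (flipIdx j p) then 2
  else 3

/-- A representative of each label. -/
def labelRep (i j k : Fin 3) (p : QIdx) : Fin 4 → QIdx :=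
  ![p, flipIdx k p, flipIdx j p, flipIdx i p]

set_option maxRecDepth 100000 in
theorem label_flipIdx : ∀ i j k : Fin 3, i ≠ j → j ≠ k → i ≠ k → ∀ p q,
    label j k p (flipIdx i q) = ![3, 2, 1, 0] (label j k p q) ∧
    label j k p (flipIdx j q) = ![2, 3, 0, 1] (label j k p q) ∧
    label j k p (flipIdx k q) = ![1, 0, 3, 2] (label j k p q) := by
  decide +kernel

set_option synthInstance.maxSize 1000 in
theorem label_labelRep : ∀ i j k : Fin 3, i ≠ j → j ≠ k → i ≠ k → ∀ (p : QIdx) (n : Fin 4),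
    label j k p (labelRep i j k p n) = n := by decide +kernel

theorem eq_or_eq_oppIdx_labelRep : ∀ i j k : Fin 3, i ≠ j → j ≠ k → i ≠ k → ∀ p q,
    q = labelRep i j k p (label j k p q) ∨ q = oppIdx (labelRep i j k p (label j k p q)) := by
  decide +kernel

/-! ### Splitting four numbers -/

/-- The combinatorial core. The labels `0, 1, 2, 3` stand for the four pairs of opposite indices;
the involutions `![3, 2, 1, 0]`, `![2, 3, 0, 1]` and `![1, 0, 3, 2]` are the flips of the qubits of
`α`, `β` and `γ`. The hypotheses on `t, t', ρ, ρ'` come from a decomposition in `β ∨ (γ ∧ α)`, those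
on `v, v', κ, κ'` from one in `γ ∨ (α ∧ β)`. In the conclusion `x, u` belong to the summand in
`α ∧ β` and `y, w` to the one in `α ∧ γ`. -/
theorem exists_add_eq_of_le (s r t t' ρ ρ' v v' κ κ' : Fin 4 → ℝ)
    (hr : ∀ n, 0 ≤ r n) (hrs : ∀ n, r n ≤ s n) (hrs' : ∀ n, r n ≤ s (![3, 2, 1, 0] n))
    (hmin : ∀ n, s 0 ≤ s n)
    (hρ : ∀ n, ρ n ≤ t n ∧ ρ n ≤ t (![2, 3, 0, 1] n))
    (hρ' : ∀ n, ρ' n ≤ t' n ∧ ρ' n ≤ t' (![1, 0, 3, 2] n) ∧ ρ' n ≤ t' (![3, 2, 1, 0] n))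
    (ht : ∀ n, t n + t' n ≤ s n) (hrρ : ∀ n, r n ≤ ρ n + ρ' n)
    (hκ : ∀ n, κ n ≤ v n ∧ κ n ≤ v (![1, 0, 3, 2] n))
    (hκ' : ∀ n, κ' n ≤ v' n ∧ κ' n ≤ v' (![3, 2, 1, 0] n) ∧ κ' n ≤ v' (![2, 3, 0, 1] n))
    (hv : ∀ n, v n + v' n ≤ s n) (hrκ : ∀ n, r n ≤ κ n + κ' n) :
    ∃ x y u w : Fin 4 → ℝ, (∀ n, 0 ≤ x n) ∧ (∀ n, 0 ≤ y n) ∧ (∀ n, 0 ≤ u n) ∧ (∀ n, 0 ≤ w n) ∧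
      (∀ n, x n + y n = s n) ∧ (∀ n, r n ≤ u n + w n) ∧
      (∀ n, u n ≤ x n ∧ u n ≤ x (![3, 2, 1, 0] n) ∧ u n ≤ x (![2, 3, 0, 1] n)) ∧
      (∀ n, w n ≤ y n ∧ w n ≤ y (![3, 2, 1, 0] n) ∧ w n ≤ y (![1, 0, 3, 2] n)) := by
  simp only [Fin.forall_fin_succ, Fin.isValue, IsEmpty.forall_iff] at hr hrs hrs' hmin hρ hρ'
  simp only [Fin.forall_fin_succ, Fin.isValue, IsEmpty.forall_iff] at ht hrρ hκ hκ' hv hrκ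
  simp at hr hrs hrs' hmin hρ hρ' ht hrρ hκ hκ' hv hrκ
  -- The consequences of the two decompositions that the construction uses.
  have h12a : r 1 + r 2 ≤ s 0 + s 1 := by linarith
  have h12b : r 1 + r 2 ≤ s 0 + s 2 := by linarith
  have h12c : r 1 + r 2 ≤ s 0 + s 3 := by linarith
  have h12d : r 1 + r 2 ≤ s 3 + s 1 := by linarith
  have h12e : r 1 + r 2 ≤ s 3 + s 2 := by linarith
  have h01 : r 0 + r 1 ≤ s 0 + s 3 := by linarith
  have h02 : r 0 + r 2 ≤ s 0 + s 3 := by linarith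
  have h31 : r 3 + r 1 ≤ s 0 + s 3 := by linarith
  have h32 : r 3 + r 2 ≤ s 0 + s 3 := by linarith
  clear hρ hρ' hκ hκ' ht hv hrρ hrκ
  -- Since `s 0` is minimal, `r 0` and `r 3` are at most every `s n`. So `r 1` and `r 2` can be raised
  -- to `R` and `Q`, which are at least `A = max (r 0) (r 3)`, at no cost elsewhere.
  obtain ⟨A, hA⟩ : ∃ A, A = max (r 0) (r 3) := ⟨_, rfl⟩
  obtain ⟨R, hR⟩ : ∃ R, R = max A (r 1) := ⟨_, rfl⟩
  obtain ⟨Q, hQ⟩ : ∃ Q, Q = max A (r 2) := ⟨_, rfl⟩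
  have hA0 : A ≤ s 0 := by rw [hA]; exact max_le (by linarith) (by linarith)
  have h0A : r 0 ≤ A := hA ▸ le_max_left _ _
  have h3A : r 3 ≤ A := hA ▸ le_max_right _ _
  have hAR : A ≤ R := hR ▸ le_max_left _ _
  have h1R : r 1 ≤ R := hR ▸ le_max_right _ _
  have hAQ : A ≤ Q := hQ ▸ le_max_left _ _
  have h2Q : r 2 ≤ Q := hQ ▸ le_max_right _ _
  have hR1 : R ≤ s 1 := by rw [hR]; exact max_le (by linarith) (by linarith)
  have hR2 : R ≤ s 2 := by rw [hR]; exact max_le (by linarith) (by linarith)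
  have hQ1 : Q ≤ s 1 := by rw [hQ]; exact max_le (by linarith) (by linarith)
  have hQ2 : Q ≤ s 2 := by rw [hQ]; exact max_le (by linarith) (by linarith)
  have hsum : ∀ c, A + A ≤ c → A + r 1 ≤ c → A + r 2 ≤ c → r 1 + r 2 ≤ c → R + Q ≤ c := by
    intro c h1 h2 h3 h4
    rcases max_choice A (r 1) with h | h <;> rcases max_choice A (r 2) with h' | h' <;>
      rw [hR, hQ, h, h'] <;> linarith
  have hA1 : A + r 1 ≤ s 0 + s 3 := by
    rcases max_choice (r 0) (r 3) with h | h <;> rw [hA, h] <;> linarith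
  have hA2 : A + r 2 ≤ s 0 + s 3 := by
    rcases max_choice (r 0) (r 3) with h | h <;> rw [hA, h] <;> linarith
  have k03 : R + Q ≤ s 0 + s 3 := hsum _ (by linarith) hA1 hA2 (by linarith)
  have k01 : R + Q ≤ s 0 + s 1 := hsum _ (by linarith) (by linarith) (by linarith) (by linarith)
  have k02 : R + Q ≤ s 0 + s 2 := hsum _ (by linarith) (by linarith) (by linarith) (by linarith)
  have k31 : R + Q ≤ s 3 + s 1 := hsum _ (by linarith) (by linarith) (by linarith) (by linarith)
  have k32 : R + Q ≤ s 3 + s 2 := hsum _ (by linarith) (by linarith) (by linarith) (by linarith)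
  -- The values are `y 0 = a`, `y 1 = y 2 = b` and `x 3 = R - a`. They make `x 3 + y 0` equal to `R`,
  -- which leaves `s 0 + s 3 - R ≥ Q` for `x 0 + y 3`; `b` is the least value with
  -- `R ≤ x 3 + b` and `Q ≤ x 0 + b`.
  obtain ⟨a, ha⟩ : ∃ a, a = min (s 0) R := ⟨_, rfl⟩
  have ha0 : a ≤ s 0 := ha ▸ min_le_left _ _
  have haR : a ≤ R := ha ▸ min_le_right _ _
  have haA : A ≤ a := by rw [ha]; exact le_min hA0 hAR
  have h3 : R - a ≤ s 3 := by
    rcases min_choice (s 0) R with h | h <;> rw [ha, h] <;> linarith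
  obtain ⟨b, hb⟩ : ∃ b, b = max a (Q - (s 0 - a)) := ⟨_, rfl⟩
  have hab : a ≤ b := hb ▸ le_max_left _ _
  have hQb : Q - (s 0 - a) ≤ b := hb ▸ le_max_right _ _
  have hble : ∀ c, a ≤ c → Q - (s 0 - a) ≤ c → b ≤ c := by
    intro c h1 h2
    rw [hb]; exact max_le h1 h2
  have b1 : b ≤ s 1 - (R - a) := hble _ (by linarith) (by linarith)
  have b2 : b ≤ s 2 - (R - a) := hble _ (by linarith) (by linarith)
  have b3 : b ≤ s 1 - (Q - (s 3 - (R - a))) := hble _ (by linarith) (by linarith)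
  have b4 : b ≤ s 2 - (Q - (s 3 - (R - a))) := hble _ (by linarith) (by linarith)
  obtain ⟨x0, hx0⟩ : ∃ z, z = s 0 - a := ⟨_, rfl⟩
  obtain ⟨x1, hx1⟩ : ∃ z, z = s 1 - b := ⟨_, rfl⟩
  obtain ⟨x2, hx2⟩ : ∃ z, z = s 2 - b := ⟨_, rfl⟩
  obtain ⟨x3, hx3⟩ : ∃ z, z = R - a := ⟨_, rfl⟩
  -- A second name for `b` keeps `simp` from merging equal arguments of `min`.
  obtain ⟨b', hb'⟩ : ∃ z, z = b := ⟨_, rfl⟩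
  obtain ⟨y3, hy3⟩ : ∃ z, z = s 3 - (R - a) := ⟨_, rfl⟩
  have key : ∀ c x x' x'' y y' y'' : ℝ, c ≤ x + y → c ≤ x + y' → c ≤ x + y'' → c ≤ x' + y →
      c ≤ x' + y' → c ≤ x' + y'' → c ≤ x'' + y → c ≤ x'' + y' → c ≤ x'' + y'' →
      c ≤ min x (min x' x'') + min y (min y' y'') := by
    intro c x x' x'' y y' y'' _ _ _ _ _ _ _ _ _
    rcases min_choice x (min x' x'') with h | h <;> rw [h] <;>
    rcases min_choice y (min y' y'') with h' | h' <;> rw [h'] <;>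
    rcases min_choice x' x'' with h'' | h'' <;> rcases min_choice y' y'' with h3 | h3 <;>
    (try simp only [h'', h3]) <;> assumption
  refine ⟨![x0, x1, x2, x3], ![a, b, b', y3],
    ![min x0 (min x3 x2), min x1 (min x2 x3), min x2 (min x1 x0), min x3 (min x0 x1)],
    ![min a (min y3 b), min b (min b' a), min b' (min b y3), min y3 (min a b')],
    ?_, ?_, ?_, ?_, ?_, ?_, ?_, ?_⟩ <;>
  simp only [Fin.forall_fin_succ, Fin.isValue, IsEmpty.forall_iff] <;> simp
  · refine ⟨?_, ?_, ?_, ?_⟩ <;> linarith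
  · refine ⟨?_, ?_, ?_, ?_⟩ <;> linarith
  · refine ⟨⟨?_, ?_, ?_⟩, ⟨?_, ?_, ?_⟩, ⟨?_, ?_, ?_⟩, ?_, ?_, ?_⟩ <;> linarith
  · refine ⟨⟨?_, ?_, ?_⟩, ⟨?_, ?_, ?_⟩, ⟨?_, ?_, ?_⟩, ?_, ?_, ?_⟩ <;> linarith
  · refine ⟨?_, ?_, ?_, ?_⟩ <;> linarith
  · refine ⟨?_, ?_, ?_, ?_⟩ <;> apply key <;> linarith

/-! ### The separable cones -/

/-- The cone hull of the pure states of product vectors for the bipartition that separates the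
qubit `i` from the other two. A function of the two other components is encoded as a function `b`
of the whole index that does not change when the qubit `i` is flipped. -/
noncomputable def sep (i : Fin 3) : PointedCone ℝ QMat :=
  PointedCone.hull ℝ
    {M | ∃ (a : Fin 2 → ℂ) (b : QIdx → ℂ), (∀ q, b (flipIdx i q) = b q) ∧
      M = pureState (fun q => a (coord i q) * b q)}

theorem apply_eq_of_eq_or_eq_flipIdx (b : QIdx → ℂ) (i : Fin 3)
    (h : ∀ q, b (flipIdx i q) = b q) (q q' : QIdx) (hq : q' = q ∨ q' = flipIdx i q) : b q' = b q := by
  rcases hq with rfl | rfl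
  · rfl
  · exact h q

theorem sepA_eq : sepA = sep 0 := by
  unfold sepA sep
  congr 1
  ext M
  constructor
  · rintro ⟨a, b, rfl⟩
    exact ⟨a, fun p => b (p.2.1, p.2.2), fun q => rfl, rfl⟩
  · rintro ⟨a, b, hb, rfl⟩
    refine ⟨a, fun t => b (0, t.1, t.2), congrArg _ (funext fun q => congrArg _ ?_)⟩
    exact apply_eq_of_eq_or_eq_flipIdx b 0 hb _ _ (by revert q; decide)

theorem sepB_eq : sepB = sep 1 := by
  unfold sepB sep
  congr 1
  ext M
  constructor
  · rintro ⟨a, b, rfl⟩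
    exact ⟨a, fun p => b (p.2.2, p.1), fun q => rfl, rfl⟩
  · rintro ⟨a, b, hb, rfl⟩
    refine ⟨a, fun t => b (t.2, 0, t.1), congrArg _ (funext fun q => congrArg _ ?_)⟩
    exact apply_eq_of_eq_or_eq_flipIdx b 1 hb _ _ (by revert q; decide)

theorem sepC_eq : sepC = sep 2 := by
  unfold sepC sep
  congr 1
  ext M
  constructor
  · rintro ⟨a, b, rfl⟩
    exact ⟨a, fun p => b (p.1, p.2.1), fun q => rfl, rfl⟩
  · rintro ⟨a, b, hb, rfl⟩
    refine ⟨a, fun t => b (t.1, t.2, 0), congrArg _ (funext fun q => congrArg _ ?_)⟩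
    exact apply_eq_of_eq_or_eq_flipIdx b 2 hb _ _ (by revert q; decide)

/-! ### Inequalities on the separable cones -/

/-- The geometric mean of the two diagonal entries at `q` and at the opposite index. The square root
is the intended one only if the diagonal is nonnegative. -/
noncomputable def diagMean (M : QMat) (q : QIdx) : ℝ :=
  √((M q q).re * (M (oppIdx q) (oppIdx q)).re)

theorem sqrt_mul_add_sqrt_mul_le {a b c d : ℝ} (ha : 0 ≤ a) (hb : 0 ≤ b) (hc : 0 ≤ c)
    (hd : 0 ≤ d) : √(a * b) + √(c * d) ≤ √((a + c) * (b + d)) := by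
  apply Real.le_sqrt_of_sq_le
  rw [Real.sqrt_mul ha, Real.sqrt_mul hc]
  nlinarith [Real.sq_sqrt ha, Real.sq_sqrt hb, Real.sq_sqrt hc, Real.sq_sqrt hd,
    sq_nonneg (√a * √d - √c * √b), mul_nonneg ha hd, mul_nonneg hc hb]

theorem diagMean_add_le {M N : QMat} (hM : ∀ q, 0 ≤ (M q q).re) (hN : ∀ q, 0 ≤ (N q q).re)
    (q : QIdx) : diagMean M q + diagMean N q ≤ diagMean (M + N) q := by
  simpa [diagMean] using sqrt_mul_add_sqrt_mul_le (hM q) (hM (oppIdx q)) (hN q) (hN (oppIdx q))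

theorem diagMean_oppIdx (M : QMat) (q : QIdx) : diagMean M (oppIdx q) = diagMean M q := by
  rw [diagMean, diagMean, oppIdx_oppIdx, mul_comm]

/-- The entrywise condition that characterises the `X`-part of `sep i`. For an `X`-shaped matrix it
says that the matrix and its partial transpose on the qubit `i` are positive. -/
structure AntidiagLE (i : Fin 3) (M : QMat) : Prop where
  diag_nonneg : ∀ q, 0 ≤ (M q q).re
  norm_le : ∀ q, ‖M q (oppIdx q)‖ ≤ diagMean M q
  norm_le_flip : ∀ q, ‖M q (oppIdx q)‖ ≤ diagMean M (flipIdx i q)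

theorem AntidiagLE.zero (i : Fin 3) : AntidiagLE i 0 :=
  ⟨by simp, by simp [diagMean], by simp [diagMean]⟩

theorem AntidiagLE.add {i : Fin 3} {M N : QMat} (hM : AntidiagLE i M) (hN : AntidiagLE i N) :
    AntidiagLE i (M + N) where
  diag_nonneg q := by simpa using add_nonneg (hM.1 q) (hN.1 q)
  norm_le q := (norm_add_le _ _).trans
    ((add_le_add (hM.2 q) (hN.2 q)).trans (diagMean_add_le hM.1 hN.1 q))
  norm_le_flip q := (norm_add_le _ _).trans
    ((add_le_add (hM.3 q) (hN.3 q)).trans (diagMean_add_le hM.1 hN.1 _))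

theorem diagMean_smul {c : ℝ} (hc : 0 ≤ c) (M : QMat) (q : QIdx) :
    diagMean (c • M) q = c * diagMean M q := by
  simp only [diagMean, Matrix.smul_apply, Complex.real_smul, Complex.re_ofReal_mul]
  rw [show ∀ x y : ℝ, c * x * (c * y) = c ^ 2 * (x * y) by intros; ring,
    Real.sqrt_mul (sq_nonneg c), Real.sqrt_sq hc]

theorem AntidiagLE.smul {i : Fin 3} {M : QMat} (hM : AntidiagLE i M) {c : ℝ} (hc : 0 ≤ c) :
    AntidiagLE i (c • M) where
  diag_nonneg q := by simpa using mul_nonneg hc (hM.1 q)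
  norm_le q := by
    rw [diagMean_smul hc, Matrix.smul_apply, norm_smul, Real.norm_of_nonneg hc]
    exact mul_le_mul_of_nonneg_left (hM.2 q) hc
  norm_le_flip q := by
    rw [diagMean_smul hc, Matrix.smul_apply, norm_smul, Real.norm_of_nonneg hc]
    exact mul_le_mul_of_nonneg_left (hM.3 q) hc

theorem diagMean_pureState (ψ : QIdx → ℂ) (q : QIdx) :
    diagMean (pureState ψ) q = ‖ψ q‖ * ‖ψ (oppIdx q)‖ := by
  have h : ∀ z : ℂ, (z * star z).re = ‖z‖ ^ 2 := by
    intro z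
    rw [Complex.star_def, Complex.mul_conj, Complex.ofReal_re, Complex.normSq_eq_norm_sq]
  simp only [diagMean, pureState, vecMulVec_apply, Pi.star_apply, h]
  rw [← mul_pow, Real.sqrt_sq (by positivity)]

theorem coord_flipIdx_eq : ∀ i q, coord i (flipIdx i q) = coord i (oppIdx q) := by decide

theorem AntidiagLE.pureState {i : Fin 3} (a : Fin 2 → ℂ) (b : QIdx → ℂ)
    (hb : ∀ q, b (flipIdx i q) = b q) :
    AntidiagLE i (pureState fun q => a (coord i q) * b q) where
  diag_nonneg q := by
    simp only [_root_.pureState, vecMulVec_apply, Pi.star_apply, Complex.star_def,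
      Complex.mul_conj, Complex.ofReal_re]
    exact Complex.normSq_nonneg _
  norm_le q := by
    rw [diagMean_pureState]
    simp [_root_.pureState, vecMulVec_apply]
  norm_le_flip q := by
    rw [diagMean_pureState]
    simp only [_root_.pureState, vecMulVec_apply, Pi.star_apply, norm_mul, norm_star, hb,
      oppIdx_flipIdx, coord_flipIdx_eq, oppIdx_oppIdx]
    exact le_of_eq (by ring)

/-- The entrywise condition is necessary for separability, whatever the shape of `M`. -/
theorem antidiagLE_of_mem_sep {i : Fin 3} {M : QMat} (hM : M ∈ sep i) : AntidiagLE i M := by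
  unfold sep at hM
  induction hM using Submodule.span_induction with
  | mem x hx =>
    obtain ⟨a, b, hb, rfl⟩ := hx
    exact AntidiagLE.pureState a b hb
  | zero => exact AntidiagLE.zero i
  | add x y _ _ hx hy => exact hx.add hy
  | smul c x _ hx => exact hx.smul c.2

/-! ### Separability of `X`-shaped matrices -/

theorem pureState_mem_sep {i : Fin 3} (a : Fin 2 → ℂ) (b : QIdx → ℂ)
    (hb : ∀ q, b (flipIdx i q) = b q) : pureState (fun q => a (coord i q) * b q) ∈ sep i :=
  PointedCone.subset_hull ⟨a, b, hb, rfl⟩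

theorem pureState_add_add_pureState_sub (u v : QIdx → ℂ) :
    pureState (u + v) + pureState (u - v) = (2 : ℝ) • (pureState u + pureState v) := by
  ext q q'
  simp [pureState, vecMulVec_apply]
  ring

theorem smul_mem_cone {σ : PointedCone ℝ QMat} {M : QMat} (hM : M ∈ σ) {c : ℝ} (hc : 0 ≤ c) :
    c • M ∈ σ := σ.smul_mem hc hM

/-- Averaging the product state of `(x₀, x₁)` and `(y₀, y₁)` with that of `(x₀, -x₁)` and `(y₀, -y₁)`
keeps the entries between opposite indices and cancels the other off-diagonal ones. -/
theorem pureState_add_pureState_mem_sep (i : Fin 3) (p : QIdx) (x₀ x₁ y₀ y₁ : ℂ) :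
    pureState (Pi.single p (x₀ * y₀) + Pi.single (oppIdx p) (x₁ * y₁)) +
      pureState (Pi.single (flipIdx i p) (x₁ * y₀) +
        Pi.single (oppIdx (flipIdx i p)) (x₀ * y₁)) ∈ sep i := by
  have key : ∀ x₁ y₁ : ℂ,
      pureState ((Pi.single p (x₀ * y₀) + Pi.single (oppIdx p) (x₁ * y₁)) +
        (Pi.single (flipIdx i p) (x₁ * y₀) + Pi.single (oppIdx (flipIdx i p)) (x₀ * y₁))) ∈
        sep i := by
    intro x₁ y₁
    have := pureState_mem_sep (i := i) (fun t => if t = coord i p then x₀ else x₁)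
      (fun q => if q = p ∨ q = flipIdx i p then y₀ else
        if q = oppIdx p ∨ q = oppIdx (flipIdx i p) then y₁ else 0) (by
          have : ∀ i p q, (flipIdx i q = p ∨ flipIdx i q = flipIdx i p ↔
              q = p ∨ q = flipIdx i p) ∧
              (flipIdx i q = oppIdx p ∨ flipIdx i q = oppIdx (flipIdx i p) ↔
              q = oppIdx p ∨ q = oppIdx (flipIdx i p)) := by decide +kernel
          intro q
          simp only [this])
    convert this using 2
    funext q
    have h1 := oppIdx_ne p
    have h2 := flipIdx_ne i p
    have h3 := flipIdx_ne_oppIdx i p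
    have h4 := oppIdx_ne (flipIdx i p)
    have h5 : oppIdx (flipIdx i p) ≠ p := by clear this; clear * -; revert i p; decide
    have h6 : oppIdx (flipIdx i p) ≠ oppIdx p := by clear this; clear * -; revert i p; decide
    have c1 := coord_flipIdx_ne i p
    have c2 := coord_oppIdx_ne i p
    have c3 := coord_oppIdx_flipIdx i p
    simp only [Pi.add_apply, Pi.single_apply]
    by_cases e1 : q = p
    · subst e1; simp [h1.symm, h2.symm, h5.symm]
    by_cases e2 : q = oppIdx p
    · subst e2; simp [h1, h3.symm, h6.symm, c2]
    by_cases e3 : q = flipIdx i p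
    · subst e3; simp [h2, h3, h4.symm, c1]
    by_cases e4 : q = oppIdx (flipIdx i p)
    · subst e4; simp [h4, h5, h6, c3]
    simp [e1, e2, e3, e4]
  have h := add_mem (key x₁ y₁) (key (-x₁) (-y₁))
  have e : ∀ u v : QIdx → ℂ, pureState u + pureState v =
      (1 / 2 : ℝ) • (pureState (u + v) + pureState (u - v)) := by
    intro u v
    rw [pureState_add_add_pureState_sub, smul_smul]
    norm_num
  rw [e]
  refine smul_mem_cone ?_ (by norm_num)
  convert h using 3
  rw [sub_eq_add_neg, neg_add, ← Pi.single_neg, ← Pi.single_neg]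
  ring_nf

/-- The self-adjoint `X`-shaped matrix supported on the indices `p` and `oppIdx p`, with diagonal
entries `a`, `b` and anti-diagonal entries `c`, `star c`. -/
noncomputable def xBlock (p : QIdx) (a b : ℝ) (c : ℂ) : QMat :=
  single p p (a : ℂ) + single (oppIdx p) (oppIdx p) (b : ℂ) + single p (oppIdx p) c +
    single (oppIdx p) p (star c)

theorem xBlock_add (p : QIdx) (a b a' b' : ℝ) (c c' : ℂ) :
    xBlock p a b c + xBlock p a' b' c' = xBlock p (a + a') (b + b') (c + c') := by
  simp only [xBlock, Complex.ofReal_add, star_add, single_add]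
  abel

theorem smul_xBlock (p : QIdx) (t a b : ℝ) (c : ℂ) :
    t • xBlock p a b c = xBlock p (t * a) (t * b) (t * c) := by
  simp [xBlock, smul_add, smul_single]

theorem pureState_single_add_single (p : QIdx) (z w : ℂ) :
    pureState (Pi.single p z + Pi.single (oppIdx p) w) =
      xBlock p (‖z‖ ^ 2) (‖w‖ ^ 2) (z * star w) := by
  have h : ∀ z : ℂ, ((‖z‖ ^ 2 : ℝ) : ℂ) = z * star z := by
    intro z
    rw [Complex.star_def, Complex.mul_conj, Complex.normSq_eq_norm_sq]
  have hs : ∀ (p : QIdx) (z : ℂ), star (Pi.single p z : QIdx → ℂ) = Pi.single p (star z) := by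
    intro p z
    ext q
    by_cases hq : q = p
    · subst hq; simp
    · simp [hq]
  have hv : ∀ (p q : QIdx) (z w : ℂ), vecMulVec (Pi.single p z) (Pi.single q w) =
      single p q (z * w) := by
    intro p q z w
    ext a b
    simp only [vecMulVec_apply, Pi.single_apply, single_apply]
    by_cases h1 : a = p <;> by_cases h2 : b = q <;> simp [h1, h2, Ne.symm]
  rw [pureState, star_add, hs, hs, vecMulVec_add, add_vecMulVec, add_vecMulVec, hv, hv, hv, hv,
    xBlock, h, h, star_mul, star_star]
  abel

theorem xBlock_add_xBlock_mem_sep_of_prod (i : Fin 3) (p : QIdx) (x₀ x₁ y₀ y₁ : ℂ) :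
    xBlock p (‖x₀ * y₀‖ ^ 2) (‖x₁ * y₁‖ ^ 2) (x₀ * y₀ * star (x₁ * y₁)) +
      xBlock (flipIdx i p) (‖x₁ * y₀‖ ^ 2) (‖x₀ * y₁‖ ^ 2) (x₁ * y₀ * star (x₀ * y₁)) ∈ sep i := by
  rw [← pureState_single_add_single, ← pureState_single_add_single]
  exact pureState_add_pureState_mem_sep i p x₀ x₁ y₀ y₁

theorem xBlock_diag_mem_sep (i : Fin 3) (p : QIdx) {a b a' b' : ℝ} (ha : 0 ≤ a) (hb : 0 ≤ b)
    (ha' : 0 ≤ a') (hb' : 0 ≤ b') :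
    xBlock p a b 0 + xBlock (flipIdx i p) a' b' 0 ∈ sep i := by
  have h1 := xBlock_add_xBlock_mem_sep_of_prod i p (√a : ℝ) 0 1 0
  have h2 := xBlock_add_xBlock_mem_sep_of_prod i p 0 (√b : ℝ) 0 1
  have h3 := xBlock_add_xBlock_mem_sep_of_prod i p 0 (√a' : ℝ) 1 0
  have h4 := xBlock_add_xBlock_mem_sep_of_prod i p (√b' : ℝ) 0 0 1
  have h := add_mem (add_mem h1 h2) (add_mem h3 h4)
  simp only [mul_one, mul_zero, zero_mul, norm_zero, star_zero, Complex.norm_real, Real.norm_eq_abs,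
    sq_abs, Real.sq_sqrt, ha, hb, ha', hb', ne_eq, OfNat.ofNat_ne_zero, not_false_eq_true,
    zero_pow] at h
  rw [add_add_add_comm (xBlock p a 0 0), add_add_add_comm (xBlock p 0 0 0),
    add_add_add_comm (xBlock p a 0 0 + _)] at h
  simpa only [xBlock_add, add_zero, zero_add] using h

/-- The extreme blocks: both anti-diagonal entries have the largest modulus `t` that the diagonal
allows. -/
theorem xBlock_mem_sep_of_norm_eq (i : Fin 3) (p : QIdx) {a b a' b' t : ℝ} {c d : ℂ}
    (ht : 0 < t) (ha : 0 < a) (ha' : 0 < a') (hab : a * b = t ^ 2) (hab' : a' * b' = t ^ 2)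
    (hc : ‖c‖ = t) (hd : ‖d‖ = t) :
    xBlock p a b c + xBlock (flipIdx i p) a' b' d ∈ sep i := by
  have hb' : 0 < b' := by
    have : 0 < a' * b' := by rw [hab']; positivity
    exact (mul_pos_iff_of_pos_left ha').1 this
  -- For the product vector of `(1, x)` and `(√a, y)` the entry `c` forces `y = star c / (√a * x)`, and
  -- then the entry `d` determines `x ^ 2`.
  obtain ⟨x, hx⟩ := IsAlgClosed.exists_pow_nat_eq (star c * d / ((a * b' : ℝ) : ℂ)) two_pos
  have hcs : c * star c = (t : ℂ) ^ 2 := by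
    rw [Complex.star_def, Complex.mul_conj, Complex.normSq_eq_norm_sq, hc]; push_cast; rfl
  have hx2 : ‖x‖ ^ 2 = a' / a := by
    rw [← norm_pow, hx, norm_div, norm_mul, norm_star, hc, hd, Complex.norm_real,
      Real.norm_of_nonneg (by positivity)]
    field_simp
    linarith
  have hx0 : x ≠ 0 := by
    rintro rfl
    rw [norm_zero] at hx2
    have : 0 < a' / a := by positivity
    simp [← hx2] at this
  have hxs : x * star x = (a' : ℂ) / a := by
    rw [Complex.star_def, Complex.mul_conj, Complex.normSq_eq_norm_sq, hx2]; push_cast; rfl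
  have hxs0 : star x ≠ 0 := by simpa using hx0
  have hsa : ((√a : ℝ) : ℂ) * ((√a : ℝ) : ℂ) = a := by
    rw [← Complex.ofReal_mul, Real.mul_self_sqrt ha.le]
  have hs0 : ((√a : ℝ) : ℂ) ≠ 0 := by
    simpa using (Real.sqrt_pos.2 ha).ne'
  have haC : (a : ℂ) ≠ 0 := by simpa using ha.ne'
  have haC' : (a' : ℂ) ≠ 0 := by simpa using ha'.ne'
  have hbC' : (b' : ℂ) ≠ 0 := by simpa using hb'.ne'
  have hssa : star ((√a : ℝ) : ℂ) = ((√a : ℝ) : ℂ) := Complex.conj_ofReal _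
  have hxy : x * (star c / (((√a : ℝ) : ℂ) * x)) = star c / ((√a : ℝ) : ℂ) := by field_simp
  have key := xBlock_add_xBlock_mem_sep_of_prod i p 1 x (√a : ℝ) (star c / (((√a : ℝ) : ℂ) * x))
  have e1 : ‖(1 : ℂ) * ((√a : ℝ) : ℂ)‖ ^ 2 = a := by
    simp [Real.sq_sqrt ha.le]
  have e2 : ‖x * (star c / (((√a : ℝ) : ℂ) * x))‖ ^ 2 = b := by
    rw [hxy, norm_div, norm_star, hc, div_pow, ← hab, Complex.norm_real, Real.norm_eq_abs, sq_abs,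
      Real.sq_sqrt ha.le]
    field_simp
  have e3 : ‖x * ((√a : ℝ) : ℂ)‖ ^ 2 = a' := by
    rw [norm_mul, mul_pow, hx2, Complex.norm_real, Real.norm_eq_abs, sq_abs,
      Real.sq_sqrt ha.le]
    field_simp
  have e4 : ‖1 * (star c / (((√a : ℝ) : ℂ) * x))‖ ^ 2 = b' := by
    rw [one_mul, norm_div, norm_mul, norm_star, hc, div_pow, mul_pow, hx2, ← hab',
      Complex.norm_real, Real.norm_eq_abs, sq_abs, Real.sq_sqrt ha.le]
    field_simp
  have e5 : 1 * ((√a : ℝ) : ℂ) * star (x * (star c / (((√a : ℝ) : ℂ) * x))) = c := by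
    rw [hxy, star_div₀, star_star, hssa]
    field_simp
  have e6 : x * ((√a : ℝ) : ℂ) * star (1 * (star c / (((√a : ℝ) : ℂ) * x))) = d := by
    rw [one_mul, star_div₀, star_star, star_mul, hssa]
    have h1 : x * ((√a : ℝ) : ℂ) * (c / (star x * ((√a : ℝ) : ℂ))) = x ^ 2 * c / (x * star x) := by
      field_simp
    rw [h1, hxs, hx]
    have h2 : star c * d / ((a * b' : ℝ) : ℂ) * c / ((a' : ℂ) / a) =
        (c * star c) * d / (a' * b') := by
      push_cast
      field_simp
    rw [h2, hcs, ← Complex.ofReal_mul, hab']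
    have : (t : ℂ) ≠ 0 := by simpa using ht.ne'
    push_cast
    field_simp
  rwa [e1, e2, e3, e4, e5, e6] at key

/-- Every point of a disc is the midpoint of two points of its boundary circle. -/
theorem exists_norm_eq_add_eq {t : ℝ} {c : ℂ} (hc : ‖c‖ ≤ t) :
    ∃ z w : ℂ, ‖z‖ = t ∧ ‖w‖ = t ∧ z + w = 2 * c := by
  have ht : 0 ≤ t := (norm_nonneg _).trans hc
  obtain ⟨u, hu, hcu⟩ : ∃ u : ℂ, ‖u‖ = 1 ∧ c = ‖c‖ * u := by
    by_cases h : c = 0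
    · exact ⟨1, by simp, by simp [h]⟩
    · have h' : ((‖c‖ : ℝ) : ℂ) ≠ 0 := by simpa using h
      refine ⟨c / ‖c‖, ?_, by field_simp⟩
      rw [norm_div, Complex.norm_real, norm_norm, div_self (by simpa using h)]
  have hsq : √(t ^ 2 - ‖c‖ ^ 2) ^ 2 = t ^ 2 - ‖c‖ ^ 2 :=
    Real.sq_sqrt (by nlinarith [norm_nonneg c])
  have hn : ∀ y : ℝ, y ^ 2 = t ^ 2 - ‖c‖ ^ 2 → ‖((‖c‖ : ℝ) + y * Complex.I : ℂ) * u‖ = t := by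
    intro y hy
    rw [norm_mul, hu, mul_one, Complex.norm_add_mul_I, hy, add_sub_cancel, Real.sqrt_sq ht]
  refine ⟨_, _, hn _ hsq, hn _ ((neg_sq _).trans hsq), ?_⟩
  conv_rhs => rw [hcu]
  push_cast
  ring

theorem xBlock_mem_sep_of_norm_le (i : Fin 3) (p : QIdx) {a b a' b' t : ℝ} {c d : ℂ}
    (ht : 0 < t) (ha : 0 < a) (ha' : 0 < a') (hab : a * b = t ^ 2) (hab' : a' * b' = t ^ 2)
    (hc : ‖c‖ ≤ t) (hd : ‖d‖ ≤ t) :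
    xBlock p a b c + xBlock (flipIdx i p) a' b' d ∈ sep i := by
  obtain ⟨z, w, hz, hw, hzw⟩ := exists_norm_eq_add_eq hc
  obtain ⟨z', w', hz', hw', hzw'⟩ := exists_norm_eq_add_eq hd
  have h := smul_mem_cone (add_mem (xBlock_mem_sep_of_norm_eq i p ht ha ha' hab hab' hz hz')
    (xBlock_mem_sep_of_norm_eq i p ht ha ha' hab hab' hw hw')) (c := 1 / 2) (by norm_num)
  rw [add_add_add_comm, xBlock_add, xBlock_add, hzw, hzw', smul_add, smul_xBlock,
    smul_xBlock] at h
  convert h using 3 <;> push_cast <;> ring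

/-- General blocks: with `t` the smaller of the two geometric means, the diagonal is shrunk until both
geometric means equal `t`, and the excess is a separable diagonal matrix. -/
theorem xBlock_add_xBlock_mem_sep (i : Fin 3) (p : QIdx) {a b a' b' : ℝ} {c d : ℂ}
    (ha : 0 ≤ a) (hb : 0 ≤ b) (ha' : 0 ≤ a') (hb' : 0 ≤ b')
    (hc : ‖c‖ ≤ √(a * b)) (hc' : ‖c‖ ≤ √(a' * b')) (hd : ‖d‖ ≤ √(a * b))
    (hd' : ‖d‖ ≤ √(a' * b')) :
    xBlock p a b c + xBlock (flipIdx i p) a' b' d ∈ sep i := by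
  obtain ⟨t, ht⟩ : ∃ t, t = min √(a * b) √(a' * b') := ⟨_, rfl⟩
  have hct : ‖c‖ ≤ t := ht ▸ le_min hc hc'
  have hdt : ‖d‖ ≤ t := ht ▸ le_min hd hd'
  have htab : t ≤ √(a * b) := ht ▸ min_le_left _ _
  have htab' : t ≤ √(a' * b') := ht ▸ min_le_right _ _
  rcases ((norm_nonneg c).trans hct).eq_or_lt with h0 | h0
  · have hc0 : c = 0 := norm_le_zero_iff.1 (h0 ▸ hct)
    have hd0 : d = 0 := norm_le_zero_iff.1 (h0 ▸ hdt)
    rw [hc0, hd0]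
    exact xBlock_diag_mem_sep i p ha hb ha' hb'
  have hpos : ∀ {a b : ℝ}, 0 ≤ a → t ≤ √(a * b) → 0 < a ∧ t ^ 2 / a ≤ b := by
    intro a b ha h
    have h1 : 0 < a * b := Real.sqrt_pos.1 (h0.trans_le h)
    have h2 : 0 < a := ha.lt_of_ne (by rintro rfl; simp at h1)
    refine ⟨h2, (div_le_iff₀ h2).2 ?_⟩
    have := (Real.le_sqrt h0.le h1.le).1 h
    linarith
  obtain ⟨hA, hB⟩ := hpos ha htab
  obtain ⟨hA', hB'⟩ := hpos ha' htab'
  have h1 := xBlock_mem_sep_of_norm_le i p h0 hA hA' (mul_div_cancel₀ (t ^ 2) hA.ne')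
    (mul_div_cancel₀ (t ^ 2) hA'.ne') hct hdt
  have h2 := xBlock_diag_mem_sep i p le_rfl (sub_nonneg.2 hB) le_rfl (sub_nonneg.2 hB')
  have h := add_mem h1 h2
  rw [add_add_add_comm, xBlock_add, xBlock_add] at h
  simpa using h

/-- For `X`-shaped matrices the entrywise condition suffices for separability. -/
theorem mem_sep_of_antidiagLE {i : Fin 3} {M : QMat} (hX : M ∈ xSpace) (hM : AntidiagLE i M) :
    M ∈ sep i := by
  obtain ⟨hH, hX⟩ := hX
  have hb : ∀ p, xBlock p (M p p).re (M (oppIdx p) (oppIdx p)).re (M p (oppIdx p)) =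
      (single p p (M p p) + single p (oppIdx p) (M p (oppIdx p))) +
      (single (oppIdx p) (oppIdx p) (M (oppIdx p) (oppIdx p)) +
        single (oppIdx p) (oppIdx (oppIdx p)) (M (oppIdx p) (oppIdx (oppIdx p)))) := by
    intro p
    have h1 : ∀ q, ((M q q).re : ℂ) = M q q := fun q => hH.coe_re_apply_self q
    rw [xBlock, h1, h1, oppIdx_oppIdx, hH.apply]
    abel
  have hblock : ∀ p, xBlock p (M p p).re (M (oppIdx p) (oppIdx p)).re (M p (oppIdx p)) +
      xBlock (flipIdx i p) (M (flipIdx i p) (flipIdx i p)).re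
        (M (oppIdx (flipIdx i p)) (oppIdx (flipIdx i p))).re
        (M (flipIdx i p) (oppIdx (flipIdx i p))) ∈ sep i := by
    intro p
    refine xBlock_add_xBlock_mem_sep i p (hM.1 _) (hM.1 _) (hM.1 _) (hM.1 _) (hM.2 _) (hM.3 _) ?_
      (hM.2 _)
    have := hM.3 (flipIdx i p)
    rwa [flipIdx_flipIdx] at this
  have hsum : M = ∑ p, (single p p (M p p) + single p (oppIdx p) (M p (oppIdx p))) := by
    ext q q'
    simp only [Matrix.sum_apply, Matrix.add_apply, single_apply, Finset.sum_add_distrib, ite_and]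
    simp only [Finset.sum_ite_eq', Finset.mem_univ, if_true]
    by_cases h1 : q' = q
    · subst h1; simp [oppIdx_ne]
    · by_cases h2 : q' = oppIdx q
      · subst h2; simp [(oppIdx_ne q).symm]
      · simp [Ne.symm h1, Ne.symm h2, hX q q' h1 h2]
  have ho : ∀ g : QIdx → QMat, ∑ p, g (oppIdx p) = ∑ p, g p := fun g =>
    Equiv.sum_comp (Function.Involutive.toPerm _ oppIdx_oppIdx) g
  have hf : ∀ g : QIdx → QMat, ∑ p, g (flipIdx i p) = ∑ p, g p := fun g =>
    Equiv.sum_comp (Function.Involutive.toPerm _ (flipIdx_flipIdx i)) g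
  -- Summing the blocks over all `p` counts each entry four times.
  have h := sum_mem (t := Finset.univ) fun p (_ : p ∈ Finset.univ) => hblock p
  rw [Finset.sum_add_distrib,
    hf fun p => xBlock p (M p p).re (M (oppIdx p) (oppIdx p)).re (M p (oppIdx p))] at h
  simp only [hb] at h
  rw [Finset.sum_add_distrib,
    ho fun p => single p p (M p p) + single p (oppIdx p) (M p (oppIdx p)), ← hsum] at h
  have h' := smul_mem_cone h (c := 1 / 4) (by norm_num)
  convert h' using 1
  module

/-! ### Splitting matrices -/

theorem comp_labelRep_label {i j k : Fin 3} (hij : i ≠ j) (hjk : j ≠ k) (hik : i ≠ k) (p : QIdx)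
    {F : QIdx → ℝ} (hF : ∀ q, F (oppIdx q) = F q) (q : QIdx) :
    F (labelRep i j k p (label j k p q)) = F q := by
  rcases eq_or_eq_oppIdx_labelRep i j k hij hjk hik p q with h | h
  · rw [← h]
  · conv_rhs => rw [h, hF]

/-- The splitting of `exists_add_eq_of_le` for functions of the index that take the same value at
opposite indices. -/
theorem exists_diagMean_split {i j k : Fin 3} (hij : i ≠ j) (hjk : j ≠ k) (hik : i ≠ k)
    {M σ τ σ' τ' : QMat} (hH : M.IsHermitian)
    (hM : AntidiagLE i M) (hστ : σ + τ = M) (hσ : AntidiagLE j σ) (hτk : AntidiagLE k τ)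
    (hτi : AntidiagLE i τ) (hστ' : σ' + τ' = M) (hσ' : AntidiagLE k σ') (hτi' : AntidiagLE i τ')
    (hτj' : AntidiagLE j τ') :
    ∃ x y u w : QIdx → ℝ, (∀ q, x (oppIdx q) = x q) ∧ (∀ q, u (oppIdx q) = u q) ∧
      (∀ q, y (oppIdx q) = y q) ∧ (∀ q, w (oppIdx q) = w q) ∧
      (∀ q, 0 ≤ x q) ∧ (∀ q, 0 ≤ y q) ∧ (∀ q, 0 ≤ u q) ∧ (∀ q, 0 ≤ w q) ∧
      (∀ q, x q + y q = diagMean M q) ∧ (∀ q, ‖M q (oppIdx q)‖ ≤ u q + w q) ∧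
      (∀ q, u q ≤ x q ∧ u q ≤ x (flipIdx i q) ∧ u q ≤ x (flipIdx j q)) ∧
      (∀ q, w q ≤ y q ∧ w q ≤ y (flipIdx i q) ∧ w q ≤ y (flipIdx k q)) := by
  obtain ⟨p, -, hp⟩ := Finset.exists_min_image Finset.univ (diagMean M) Finset.univ_nonempty
  have hlab := label_flipIdx i j k hij hjk hik p
  have hrep := label_labelRep i j k hij hjk hik p
  -- On representatives, the three flips act through permutations of the labels.
  have hflip : ∀ (N : QMat) (n : Fin 4),
      diagMean N (flipIdx i (labelRep i j k p n)) =
        diagMean N (labelRep i j k p (![3, 2, 1, 0] n)) ∧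
      diagMean N (flipIdx j (labelRep i j k p n)) =
        diagMean N (labelRep i j k p (![2, 3, 0, 1] n)) ∧
      diagMean N (flipIdx k (labelRep i j k p n)) =
        diagMean N (labelRep i j k p (![1, 0, 3, 2] n)) := by
    intro N n
    have h := hlab (labelRep i j k p n)
    rw [hrep] at h
    rw [← h.1, ← h.2.1, ← h.2.2]
    refine ⟨?_, ?_, ?_⟩ <;>
      exact (comp_labelRep_label hij hjk hik p (diagMean_oppIdx N) _).symm
  have hadd : ∀ {σ τ : QMat} {a b : Fin 3}, σ + τ = M → AntidiagLE a σ → AntidiagLE b τ → ∀ q,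
      diagMean σ q + diagMean τ q ≤ diagMean M q := by
    intro σ τ a b h hσ hτ q
    rw [← h]
    exact diagMean_add_le hσ.1 hτ.1 q
  have hnorm : ∀ {σ τ : QMat}, σ + τ = M → ∀ q,
      ‖M q (oppIdx q)‖ ≤ ‖σ q (oppIdx q)‖ + ‖τ q (oppIdx q)‖ := by
    intro σ τ h q
    rw [← h]
    exact norm_add_le _ _
  have hMopp : ∀ q, ‖M (oppIdx q) (oppIdx (oppIdx q))‖ = ‖M q (oppIdx q)‖ := by
    intro q
    rw [oppIdx_oppIdx, ← hH.apply, norm_star]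
  let e := labelRep i j k p
  obtain ⟨x, y, u, w, hx, hy, hu, hw, hxy, hr, hux, hwy⟩ := exists_add_eq_of_le
    (fun n => diagMean M (e n)) (fun n => ‖M (e n) (oppIdx (e n))‖)
    (fun n => diagMean σ (e n)) (fun n => diagMean τ (e n))
    (fun n => ‖σ (e n) (oppIdx (e n))‖) (fun n => ‖τ (e n) (oppIdx (e n))‖)
    (fun n => diagMean σ' (e n)) (fun n => diagMean τ' (e n))
    (fun n => ‖σ' (e n) (oppIdx (e n))‖) (fun n => ‖τ' (e n) (oppIdx (e n))‖)
    (fun n => norm_nonneg _) (fun n => hM.2 _) (fun n => (hM.3 _).trans_eq (hflip M n).1)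
    (fun n => hp _ (Finset.mem_univ _))
    (fun n => ⟨hσ.2 _, (hσ.3 _).trans_eq (hflip σ n).2.1⟩)
    (fun n => ⟨hτk.2 _, (hτk.3 _).trans_eq (hflip τ n).2.2, (hτi.3 _).trans_eq (hflip τ n).1⟩)
    (fun n => hadd hστ hσ hτk _) (fun n => hnorm hστ _)
    (fun n => ⟨hσ'.2 _, (hσ'.3 _).trans_eq (hflip σ' n).2.2⟩)
    (fun n => ⟨hτi'.2 _, (hτi'.3 _).trans_eq (hflip τ' n).1,
      (hτj'.3 _).trans_eq (hflip τ' n).2.1⟩)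
    (fun n => hadd hστ' hσ' hτi' _) (fun n => hnorm hστ' _)
  have hlo : ∀ q, label j k p (oppIdx q) = label j k p q := by
    have : ∀ j k p q, label j k p (oppIdx q) = label j k p q := by decide +kernel
    exact this j k p
  refine ⟨fun q => x (label j k p q), fun q => y (label j k p q),
    fun q => u (label j k p q), fun q => w (label j k p q), fun q => congrArg x (hlo q),
    fun q => congrArg u (hlo q), fun q => congrArg y (hlo q), fun q => congrArg w (hlo q),
    fun q => hx _, fun q => hy _,
    fun q => hu _, fun q => hw _, fun q => ?_, fun q => ?_, fun q => ?_, fun q => ?_⟩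
  · exact (hxy _).trans (comp_labelRep_label hij hjk hik p (diagMean_oppIdx M) q)
  · exact (comp_labelRep_label hij hjk hik p (F := fun q => ‖M q (oppIdx q)‖) hMopp q).symm.trans_le
      (hr _)
  · simpa only [hlab] using hux (label j k p q)
  · simpa only [hlab] using hwy (label j k p q)

/-- The matrix `M` with its diagonal entries scaled by `t` and all others by `κ`, both evaluated at the
row index. -/
noncomputable def xScale (t κ : QIdx → ℝ) (M : QMat) : QMat :=
  Matrix.of fun q q' => if q' = q then (t q : ℂ) * M q q' else (κ q : ℂ) * M q q'

theorem xScale_mem {t κ : QIdx → ℝ} {M : QMat} (hM : M ∈ xSpace)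
    (hκ : ∀ q, κ (oppIdx q) = κ q) : xScale t κ M ∈ xSpace := by
  obtain ⟨hH, hX⟩ := hM
  refine ⟨?_, fun q q' h h' => by simp [xScale, hX q q' h h']⟩
  refine Matrix.IsHermitian.ext fun q q' => ?_
  by_cases h : q' = q
  · subst h
    simp [xScale, hH.apply]
  by_cases h' : q' = oppIdx q
  · subst h'
    simp [xScale, (oppIdx_ne q).symm, oppIdx_ne, hκ, hH.apply]
  · have h1 : q ≠ oppIdx q' := by
      rintro rfl
      exact h' (oppIdx_oppIdx q').symm
    simp [xScale, hX q q' h h', hX q' q (Ne.symm h) h1]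

theorem diagMean_xScale {t κ : QIdx → ℝ} {M : QMat} (ht : ∀ q, 0 ≤ t q)
    (hopp : ∀ q, t (oppIdx q) = t q) (q : QIdx) :
    diagMean (xScale t κ M) q = t q * diagMean M q := by
  simp only [diagMean, xScale, Matrix.of_apply, if_true, Complex.re_ofReal_mul, hopp]
  rw [show ∀ c x y : ℝ, c * x * (c * y) = c ^ 2 * (x * y) by intros; ring,
    Real.sqrt_mul (sq_nonneg _), Real.sqrt_sq (ht q)]

theorem norm_xScale {t κ : QIdx → ℝ} {M : QMat} (hκ : ∀ q, 0 ≤ κ q) (q : QIdx) :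
    ‖xScale t κ M q (oppIdx q)‖ = κ q * ‖M q (oppIdx q)‖ := by
  simp [xScale, oppIdx_ne, abs_of_nonneg (hκ q)]

theorem div_add_mul_le {u w r : ℝ} (hu : 0 ≤ u) (hw : 0 ≤ w) (hr : r ≤ u + w) :
    u / (u + w) * r ≤ u := by
  rcases (add_nonneg hu hw).eq_or_lt with h | h
  · simp [← h, hu]
  · rw [div_mul_eq_mul_div, div_le_iff₀ h]
    exact mul_le_mul_of_nonneg_left hr hu

theorem div_add_mul_self {x y : ℝ} (hx : 0 ≤ x) (hy : 0 ≤ y) : x / (x + y) * (x + y) = x := by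
  rcases (add_nonneg hx hy).eq_or_lt with h | h
  · rw [← h]; linarith
  · exact div_mul_cancel₀ _ h.ne'

theorem one_sub_div_mul_eq {x y s : ℝ} (hx : 0 ≤ x) (hy : 0 ≤ y) (h : x + y = s) :
    x / (x + y) * s = x ∧ (1 - x / (x + y)) * s = y := by
  subst h
  have := div_add_mul_self hx hy
  exact ⟨this, by linarith⟩

/-- The nontrivial inclusion, for an arbitrary order `i, j, k` of the three qubits. -/
theorem mem_sup_of_mem {i j k : Fin 3} (hij : i ≠ j) (hjk : j ≠ k) (hik : i ≠ k) {M : QMat}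
    (hX : M ∈ xSpace) (hM : M ∈ sep i) (h : M ∈ sep j ⊔ (sep k ⊓ sep i))
    (h' : M ∈ sep k ⊔ (sep i ⊓ sep j)) :
    M ∈ (xPart (sep i) ⊓ xPart (sep j)) ⊔ (xPart (sep i) ⊓ xPart (sep k)) := by
  obtain ⟨σ, hσ, τ, ⟨hτk, hτi⟩, hστ⟩ := Submodule.mem_sup.1 h
  obtain ⟨σ', hσ', τ', ⟨hτi', hτj'⟩, hστ'⟩ := Submodule.mem_sup.1 h'
  have hMi := antidiagLE_of_mem_sep hM
  obtain ⟨x, y, u, w, xo, uo, yo, wo, hx, hy, hu, hw, hxy, hr, hux, hwy⟩ :=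
    exists_diagMean_split hij hjk hik hX.1 hMi hστ (antidiagLE_of_mem_sep hσ)
    (antidiagLE_of_mem_sep hτk) (antidiagLE_of_mem_sep hτi) hστ' (antidiagLE_of_mem_sep hσ')
    (antidiagLE_of_mem_sep hτi') (antidiagLE_of_mem_sep hτj')
  have hdiv : ∀ {a b : ℝ}, 0 ≤ a → 0 ≤ b → 0 ≤ a / (a + b) ∧ 0 ≤ 1 - a / (a + b) := by
    intro a b ha hb
    exact ⟨by positivity, sub_nonneg.2 (div_le_one_of_le₀ (by linarith) (by linarith))⟩
  -- Where `x q + y q = 0` the quotient is `0`, which is harmless: the entries to be scaled have zero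
  -- geometric mean there. The same holds for `κ`, where the anti-diagonal entry itself vanishes.
  obtain ⟨t, ht⟩ : ∃ t : QIdx → ℝ, ∀ q, t q = x q / (x q + y q) := ⟨_, fun _ => rfl⟩
  obtain ⟨κ, hκ⟩ : ∃ κ : QIdx → ℝ, ∀ q, κ q = u q / (u q + w q) := ⟨_, fun _ => rfl⟩
  have t0 : ∀ q, 0 ≤ t q := fun q => ht q ▸ (hdiv (hx q) (hy q)).1
  have t1 : ∀ q, 0 ≤ 1 - t q := fun q => ht q ▸ (hdiv (hx q) (hy q)).2
  have κ0 : ∀ q, 0 ≤ κ q := fun q => hκ q ▸ (hdiv (hu q) (hw q)).1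
  have κ1 : ∀ q, 0 ≤ 1 - κ q := fun q => hκ q ▸ (hdiv (hu q) (hw q)).2
  have topp : ∀ q, t (oppIdx q) = t q := fun q => by rw [ht, ht, xo, yo]
  have κo : ∀ q, κ (oppIdx q) = κ q := fun q => by rw [hκ, hκ, uo, wo]
  have hd : ∀ q, diagMean (xScale t κ M) q = x q := fun q => by
    rw [diagMean_xScale t0 topp, ht]
    exact (one_sub_div_mul_eq (hx q) (hy q) (hxy q)).1
  have hd' : ∀ q, diagMean (xScale (fun q => 1 - t q) (fun q => 1 - κ q) M) q = y q := fun q => by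
    rw [diagMean_xScale t1 (fun q => by rw [topp]), ht]
    exact (one_sub_div_mul_eq (hx q) (hy q) (hxy q)).2
  have hn : ∀ q, ‖xScale t κ M q (oppIdx q)‖ ≤ u q := fun q => by
    rw [norm_xScale κ0, hκ]
    exact div_add_mul_le (hu q) (hw q) (hr q)
  have hn' : ∀ q, ‖xScale (fun q => 1 - t q) (fun q => 1 - κ q) M q (oppIdx q)‖ ≤ w q := by
    intro q
    rw [norm_xScale κ1]
    have h1 := one_sub_div_mul_eq (hu q) (hw q) rfl
    rw [← hκ] at h1
    exact (mul_le_mul_of_nonneg_left (hr q) (κ1 q)).trans_eq h1.2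
  have hdiag : ∀ {t κ : QIdx → ℝ}, (∀ q, 0 ≤ t q) → ∀ q, 0 ≤ (xScale t κ M q q).re := by
    intro t κ h q
    simpa [xScale] using mul_nonneg (h q) (hMi.1 q)
  have hm := xScale_mem (t := t) hX κo
  have hm' := xScale_mem (t := fun q => 1 - t q) (κ := fun q => 1 - κ q) hX
    (fun q => by rw [κo])
  refine Submodule.mem_sup.2 ⟨xScale t κ M, ⟨⟨?_, hm⟩, ?_, hm⟩,
    xScale (fun q => 1 - t q) (fun q => 1 - κ q) M, ⟨⟨?_, hm'⟩, ?_, hm'⟩, ?_⟩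
  · refine mem_sep_of_antidiagLE hm ⟨hdiag t0, fun q => ?_, fun q => ?_⟩
    · rw [hd]; exact (hn q).trans (hux q).1
    · rw [hd]; exact (hn q).trans (hux q).2.1
  · refine mem_sep_of_antidiagLE hm ⟨hdiag t0, fun q => ?_, fun q => ?_⟩
    · rw [hd]; exact (hn q).trans (hux q).1
    · rw [hd]; exact (hn q).trans (hux q).2.2
  · refine mem_sep_of_antidiagLE hm' ⟨hdiag t1, fun q => ?_, fun q => ?_⟩
    · rw [hd']; exact (hn' q).trans (hwy q).1
    · rw [hd']; exact (hn' q).trans (hwy q).2.1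
  · refine mem_sep_of_antidiagLE hm' ⟨hdiag t1, fun q => ?_, fun q => ?_⟩
    · rw [hd']; exact (hn' q).trans (hwy q).1
    · rw [hd']; exact (hn' q).trans (hwy q).2.2
  · ext q q'
    simp only [Matrix.add_apply, xScale, Matrix.of_apply]
    split_ifs <;> push_cast <;> ring

theorem sup_eq_inf_xPart {i j k : Fin 3} (hij : i ≠ j) (hjk : j ≠ k) (hik : i ≠ k)
    {P : PointedCone ℝ QMat}
    (hP : P = (sep i ⊔ (sep j ⊓ sep k)) ⊓ (sep j ⊔ (sep k ⊓ sep i)) ⊓ (sep k ⊔ (sep i ⊓ sep j))) :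
    (xPart (sep i) ⊓ xPart (sep j)) ⊔ (xPart (sep i) ⊓ xPart (sep k)) =
      xPart (sep i) ⊓ xPart P := by
  apply le_antisymm
  · subst hP
    refine sup_le ?_ ?_
    · rintro M ⟨⟨hi, hX⟩, hj, -⟩
      exact ⟨⟨hi, hX⟩, ⟨⟨Submodule.mem_sup_left hi, Submodule.mem_sup_left hj⟩,
        Submodule.mem_sup_right ⟨hi, hj⟩⟩, hX⟩
    · rintro M ⟨⟨hi, hX⟩, hk, -⟩
      exact ⟨⟨hi, hX⟩, ⟨⟨Submodule.mem_sup_left hi, Submodule.mem_sup_right ⟨hk, hi⟩⟩,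
        Submodule.mem_sup_left hk⟩, hX⟩
  · subst hP
    rintro M ⟨⟨hi, hX⟩, ⟨⟨-, hj⟩, hk⟩, -⟩
    exact mem_sup_of_mem hij hjk hik hX hi hj hk

theorem corollary3p2 :
    (xPart sepA ⊓ xPart sepB) ⊔ (xPart sepA ⊓ xPart sepC) = xPart sepA ⊓ xPart coneP ∧
    (xPart sepB ⊓ xPart sepC) ⊔ (xPart sepB ⊓ xPart sepA) = xPart sepB ⊓ xPart coneP ∧
    (xPart sepC ⊓ xPart sepA) ⊔ (xPart sepC ⊓ xPart sepB) = xPart sepC ⊓ xPart coneP := by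
  have hP : coneP = (sep 0 ⊔ (sep 1 ⊓ sep 2)) ⊓ (sep 1 ⊔ (sep 2 ⊓ sep 0)) ⊓
      (sep 2 ⊔ (sep 0 ⊓ sep 1)) := by
    rw [coneP, sepA_eq, sepB_eq, sepC_eq]
  rw [sepA_eq, sepB_eq, sepC_eq]
  refine ⟨sup_eq_inf_xPart (by decide) (by decide) (by decide) hP,
    sup_eq_inf_xPart (by decide) (by decide) (by decide) ?_,
    sup_eq_inf_xPart (by decide) (by decide) (by decide) ?_⟩
  · rw [hP]; ac_rfl
  · rw [hP]; ac_rfl
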